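/- Let $a, b$ be coprime integers with $a > b \ge 1$. Every positive integer $n$ has a unique representation $$n = \frac1b\sum_{k=0}^{\ell(n)-1}\varepsilon_k(n)\Big(\frac ab\Big)^k,\qquad \varepsilon_k(n)\in\{0,1,\ldots,a-1\},\quad \varepsilon_{\ell(n)-1}(n)\neq 0,$$ called the representation of $n$ in base $a/b$. Let $$\mathfrak z_{a/b} = \sum_{n=1}^\infty\sum_{k=1}^{\ell(n)}\frac{\varepsilon_{\ell(n)-k}(n)}{a^{\,k+\sum_{j=1}^{n-1}\ell(j)}}.$$ Then $\mathfrak z_{a/b}\in(0,1)$; its standard base-$a$ expansion is the concatenation of the base-$a/b$ representations of $1,2,3,\ldots$, each written with its most significant digit first; and $\mathfrak z_{a/b}$ is normal in base $a$. That is, if $z_1,z_2,\ldots$ are the digits of the standard base-$a$ expansion of $\mathfrak z_{a/b}$, then for every finite word $w=(w_1,\ldots,w_r)$ over $\{0,1,\ldots,a-1\}$, $$\lim_{N\to\infty}\frac1N\,\#\{1\le n\le N:\ (z_n,\ldots,z_{n+r-1})=w\}=a^{-r}.$$ -/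

import Mathlib

open Filter Topology

namespace RationalBase

/-- `l` (least significant digit first) is a representation of `n` in base `a/b`:
`n = (1/b) * ∑_{k < ℓ} ε_k (a/b)^k`, where `ℓ` is the length of `l`, the digits `ε_k` of `l` lie in
`{0, …, a-1}`, and the most significant digit `ε_{ℓ-1}` is not zero. -/
structure IsRepr (a b n : ℕ) (l : List ℕ) : Prop where
  digit_lt : ∀ d ∈ l, d < a
  lead_ne_zero : ∀ h : l ≠ [], l.getLast h ≠ 0
  value : (n : ℚ) = 1 / b * ∑ k ∈ Finset.range l.length, (l.getD k 0 : ℚ) * ((a : ℚ) / b) ^ k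

/-- The digits of `n` in base `a/b`, least significant digit first, for `b < a`. The digits come
from the division `b * n = a * n' + ε` with `0 ≤ ε < a`, repeated with `n'` in place of `n`.
The theorem `isRepr_iff` below shows that this is the unique representation of `n`. -/
def digits (a b n : ℕ) : List ℕ :=
  if h : 0 < n ∧ b < a then (b * n % a) :: digits a b (b * n / a) else []
termination_by n
decreasing_by
  exact Nat.div_lt_of_lt_mul (Nat.mul_lt_mul_of_pos_right h.2 h.1)

/-- The number `ℓ(n)` of digits of `n` in base `a/b`. -/
def len (a b n : ℕ) : ℕ := (digits a b n).length

/-- The digit `ε_k(n)` of `n` in base `a/b` at position `k` (position `0` is the least significant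
one). -/
def digit (a b k n : ℕ) : ℕ := (digits a b n).getD k 0

theorem digits_zero (a b : ℕ) : digits a b 0 = [] := by
  rw [digits]; simp

theorem digits_pos {a b n : ℕ} (hn : 0 < n) (hab : b < a) :
    digits a b n = (b * n % a) :: digits a b (b * n / a) := by
  rw [digits]; simp [hn, hab]

theorem value_cons (a b d : ℕ) (l : List ℕ) (hb : 0 < b) :
    1 / (b : ℚ) * ∑ k ∈ Finset.range (d :: l).length,
        ((d :: l).getD k 0 : ℚ) * ((a : ℚ) / b) ^ k
      = (d + a * (1 / (b : ℚ) * ∑ k ∈ Finset.range l.length,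
        (l.getD k 0 : ℚ) * ((a : ℚ) / b) ^ k)) / b := by
  rw [List.length_cons, Finset.sum_range_succ']
  have hb' : (b : ℚ) ≠ 0 := by positivity
  simp only [List.getD_cons_succ, List.getD_cons_zero, pow_succ, ← mul_assoc, ← Finset.sum_mul]
  field_simp
  ring

theorem isRepr_digits {a b : ℕ} (hb : 0 < b) (hab : b < a) (n : ℕ) :
    IsRepr a b n (digits a b n) := by
  induction n using Nat.strong_induction_on with
  | _ n ih =>
    rcases Nat.eq_zero_or_pos n with rfl | hn
    · rw [digits_zero]
      exact ⟨by simp, by simp, by simp⟩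
    · have hlt : b * n / a < n := Nat.div_lt_of_lt_mul (Nat.mul_lt_mul_of_pos_right hab hn)
      have h := ih _ hlt
      rw [digits_pos hn hab]
      refine ⟨?_, ?_, ?_⟩
      · intro d hd
        rcases List.mem_cons.1 hd with rfl | hd
        · exact Nat.mod_lt _ (by omega)
        · exact h.digit_lt d hd
      · intro _
        by_cases hl : digits a b (b * n / a) = []
        · have h0 : b * n / a = 0 := by
            by_contra h0
            rw [digits_pos (Nat.pos_of_ne_zero h0) hab] at hl
            simp at hl
          have hlt' : b * n < a := by
            rcases Nat.div_eq_zero_iff.1 h0 with h1 | h1 <;> omega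
          simp only [hl, List.getLast_singleton, Nat.mod_eq_of_lt hlt']
          positivity
        · rw [List.getLast_cons hl]
          exact h.lead_ne_zero hl
      · rw [value_cons _ _ _ _ hb, ← h.value, eq_div_iff (by positivity)]
        have := Nat.mod_add_div (b * n) a
        rw [mul_comm]
        exact_mod_cast this.symm

/-- The value of a list of digits becomes an integer after multiplication by a power of `b`. -/
theorem exists_pow_mul_value (a b : ℕ) (hb : 0 < b) (l : List ℕ) :
    ∃ m : ℕ, (b : ℚ) ^ (l.length) * (1 / b * ∑ k ∈ Finset.range l.length,
      (l.getD k 0 : ℚ) * ((a : ℚ) / b) ^ k) = m := by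
  induction l with
  | nil => exact ⟨0, by simp⟩
  | cons d l ih =>
    obtain ⟨m, hm⟩ := ih
    refine ⟨b ^ l.length * d + a * m, ?_⟩
    rw [value_cons _ _ _ _ hb, List.length_cons]
    push_cast
    rw [← hm]
    have hb' : (b : ℚ) ≠ 0 := by positivity
    rw [pow_succ]
    field_simp

theorem IsRepr.eq_digits {a b : ℕ} (hb : 0 < b) (hab : b < a) (hco : a.Coprime b)
    (l : List ℕ) : ∀ n : ℕ, IsRepr a b n l → l = digits a b n := by
  induction l with
  | nil =>
    intro n h
    have := h.value
    simp at this
    rw [this, digits_zero]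
  | cons d l ih =>
    intro n h
    have hb' : (b : ℚ) ≠ 0 := by positivity
    have hv := h.value
    rw [value_cons _ _ _ _ hb, eq_div_iff hb'] at hv
    obtain ⟨m, hm⟩ := exists_pow_mul_value a b hb l
    set v : ℚ := 1 / (b : ℚ) * ∑ k ∈ Finset.range l.length,
      (l.getD k 0 : ℚ) * ((a : ℚ) / b) ^ k with hvdef
    have hv0 : 0 ≤ v := by
      rw [hvdef]; positivity
    have hd : d < a := h.digit_lt d (by simp)
    have ha : 0 < a := by omega
    have hle : d ≤ n * b := by
      have : (d : ℚ) ≤ n * b := by rw [hv]; nlinarith [mul_nonneg (Nat.cast_nonneg (α := ℚ) a) hv0]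
      exact_mod_cast this
    obtain ⟨c, hc⟩ := Nat.exists_eq_add_of_le hle
    have hcv : (c : ℚ) = a * v := by
      have : (n : ℚ) * b = d + c := by exact_mod_cast hc
      linarith
    have hdvd : a ∣ b ^ l.length * c := by
      refine ⟨m, ?_⟩
      have : (b : ℚ) ^ l.length * c = a * m := by rw [hcv, ← hm]; ring
      exact_mod_cast this
    obtain ⟨v', rfl⟩ := (hco.pow_right l.length).dvd_of_dvd_mul_left hdvd
    have ha' : (a : ℚ) ≠ 0 := by positivity
    have hvv : (v' : ℚ) = v := by
      push_cast at hcv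
      exact mul_left_cancel₀ ha' hcv
    have hl : l = digits a b v' := by
      refine ih v' ⟨fun e he => h.digit_lt e (by simp [he]), fun hne => ?_, hvv⟩
      have := h.lead_ne_zero (by simp)
      rwa [List.getLast_cons hne] at this
    have hn : 0 < n := by
      rcases Nat.eq_zero_or_pos n with rfl | hn
      · exfalso
        have hd0 : d = 0 := by omega
        have hv'0 : v' = 0 := by
          have : a * v' = 0 := by omega
          rcases Nat.mul_eq_zero.1 this with h1 | h1 <;> omega
        subst hd0 hv'0
        rw [digits_zero] at hl
        subst hl
        exact h.lead_ne_zero (by simp) (by simp)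
      · exact hn
    have hbn : b * n = d + a * v' := by rw [mul_comm]; exact hc
    rw [digits_pos hn hab, hbn, Nat.add_mul_mod_self_left, Nat.mod_eq_of_lt hd,
      Nat.add_mul_div_left _ _ ha, Nat.div_eq_of_lt hd, zero_add, ← hl]

/-- Existence and uniqueness: `digits a b n` is the one and only representation of `n` in
base `a/b`. -/
theorem isRepr_iff {a b : ℕ} (hb : 0 < b) (hab : b < a) (hco : a.Coprime b) (n : ℕ)
    (l : List ℕ) : IsRepr a b n l ↔ l = digits a b n :=
  ⟨IsRepr.eq_digits hb hab hco l n, fun h => h ▸ isRepr_digits hb hab n⟩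

/-- The position, in the concatenation of the representations of `1, 2, 3, …`, at which
the representation of `n` begins: `∑_{1 ≤ j < n} ℓ(j)`. -/
def offset (a b n : ℕ) : ℕ := ∑ j ∈ Finset.Ico 1 n, len a b j

/-- The real number `z_{a/b} = ∑_{n ≥ 1} ∑_{k=1}^{ℓ(n)} ε_{ℓ(n)-k}(n) / a^{k + ∑_{j=1}^{n-1} ℓ(j)}`.
(The series is indexed by `n + 1` with `n : ℕ`.) -/
noncomputable def champernowne (a b : ℕ) : ℝ :=
  ∑' n : ℕ, ∑ k ∈ Finset.Icc 1 (len a b (n + 1)),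
    (digit a b (len a b (n + 1) - k) (n + 1) : ℝ) / (a : ℝ) ^ (k + offset a b (n + 1))

/-- `countWord z w N` is the number of indices `n < N` at which the word `w` occurs in the
sequence `z` of digits, read from left to right. -/
def countWord {a : ℕ} (z : ℕ → Fin a) (w : List (Fin a)) (N : ℕ) : ℕ :=
  ((Finset.range N).filter fun n => ∀ i : Fin w.length, z (n + i) = w.get i).card

/-- `x` is normal in base `a`: every word `w` over the digits `{0, …, a-1}` occurs with
frequency `a^{-|w|}` in the standard base `a` expansion of the fractional part of `x`. -/
def IsNormal (a : ℕ) [NeZero a] (x : ℝ) : Prop :=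
  ∀ w : List (Fin a),
    Tendsto (fun N : ℕ => (countWord (Real.digits (Int.fract x) a) w N : ℝ) / N) atTop
      (𝓝 (1 / (a : ℝ) ^ w.length))

end RationalBase

/-!
Deleting the last digit of `n` in base `a/b` is the map `dropDigit n = ⌊b * n / a⌋`, so the digit at
position `k` of `n` is `b * dropDigit^[k] n % a`. As `b` is invertible modulo powers of `a`, a word
of length `r` occurs in `n` with its last letter at position `k` if and only if `dropDigit^[k] n`
lies in one particular residue class modulo `a ^ r` (`exists_residue_occursAt`). Normality is
thereby reduced to the equidistribution modulo `a ^ r` of the truncations `dropDigit^[k] n`.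

The fibre of `dropDigit^[k]` over `m` is an interval whose endpoints are values of the lower adjoint
`leastLift^[k]`. Its length `fiberCard k m` is comparable to `(a/b)^k` but depends on `m`. Two facts
make this harmless: `fiberCard J` is periodic modulo `b ^ J` (`fiberCard_add_mul`), and for `k ≥ J`
the function `fiberCard k` is a multiple of `fiberCard J` up to a relative error of order `(b/a)^J`
(`abs_fiberCard_add_sub_le`). Since `b ^ J` is coprime to `a ^ r`, the periodic part does not
correlate with residue classes modulo `a ^ r` (`abs_sum_centred_mul_le`). Summing over `k`, the
discrepancy of a word in the representations of the numbers below `n` is at most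
`K_J * n + O((b/a)^J) * n * len n` (`exists_abs_sum_sum_centred_le`), while the total length of these
representations is at least of order `n * len n` (`exists_mul_len_le`). The positions where the word
straddles two representations are `O(n)` in number. Letting the position tend to infinity, and then
`J`, gives the frequency `a ^ (-r)`.

The digits of the real number are those of the concatenation because infinitely many of them, the
last digits of the multiples of `a`, are `0` (`digits_ofDigits`, `exists_concat_ne`).
-/

namespace RationalBase

/-! ### Deleting the last digit, and its lower adjoint -/

/-- The number obtained from `n` by deleting its least significant digit in base `a/b`. -/
def dropDigit (a b n : ℕ) : ℕ := b * n / a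

/-- The least `n` with `m ≤ dropDigit a b n`, that is, `⌈a * m / b⌉`. -/
def leastLift (a b m : ℕ) : ℕ := (a * m + b - 1) / b

theorem dropDigit_iterate_zero (a b k : ℕ) : (dropDigit a b)^[k] 0 = 0 := by
  induction k with
  | zero => rfl
  | succ k ih => rw [Function.iterate_succ_apply', ih]; simp [dropDigit]

theorem digit_eq {a b : ℕ} (hab : b < a) (k n : ℕ) :
    digit a b k n = b * (dropDigit a b)^[k] n % a := by
  induction k generalizing n with
  | zero =>
    rcases Nat.eq_zero_or_pos n with rfl | hn
    · simp [digit, digits_zero]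
    · simp [digit, digits_pos hn hab]
  | succ k ih =>
    rcases Nat.eq_zero_or_pos n with rfl | hn
    · rw [dropDigit_iterate_zero]; simp [digit, digits_zero]
    · rw [Function.iterate_succ_apply, ← ih]
      simp [digit, digits_pos hn hab, dropDigit]

theorem len_zero (a b : ℕ) : len a b 0 = 0 := by simp [len, digits_zero]

theorem len_of_pos {a b n : ℕ} (hn : 0 < n) (hab : b < a) :
    len a b n = len a b (dropDigit a b n) + 1 := by
  simp [len, digits_pos hn hab, dropDigit]

theorem lt_len_iff {a b : ℕ} (hab : b < a) (k n : ℕ) :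
    k < len a b n ↔ 0 < (dropDigit a b)^[k] n := by
  induction k generalizing n with
  | zero =>
    rcases Nat.eq_zero_or_pos n with rfl | hn
    · simp [len_zero]
    · simp [len_of_pos hn hab, hn]
  | succ k ih =>
    rcases Nat.eq_zero_or_pos n with rfl | hn
    · rw [dropDigit_iterate_zero]; simp [len_zero]
    · rw [Function.iterate_succ_apply, ← ih, len_of_pos hn hab]; omega

theorem dropDigit_mono (a b : ℕ) : Monotone (dropDigit a b) := fun _ _ h =>
  Nat.div_le_div_right (Nat.mul_le_mul_left _ h)

theorem len_mono {a b : ℕ} (hab : b < a) : Monotone (len a b) := fun m n h => by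
  by_contra hlt
  have h1 := (lt_len_iff hab _ _).1 (not_le.1 hlt)
  have h2 := (lt_len_iff hab _ _).2 (h1.trans_le ((dropDigit_mono a b).iterate _ h))
  exact lt_irrefl _ h2

theorem len_pos {a b n : ℕ} (hab : b < a) (hn : 0 < n) : 0 < len a b n := by
  rw [lt_len_iff hab]; exact hn

theorem len_le_self {a b : ℕ} (hab : b < a) (n : ℕ) : len a b n ≤ n := by
  induction n using Nat.strong_induction_on with
  | _ n ih =>
    rcases Nat.eq_zero_or_pos n with rfl | hn
    · simp [len_zero]
    · have hlt : dropDigit a b n < n :=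
        Nat.div_lt_of_lt_mul (Nat.mul_lt_mul_of_pos_right hab hn)
      have := ih _ hlt
      rw [len_of_pos hn hab]; omega

theorem len_le_add_len_iterate {a b : ℕ} (hab : b < a) (q n : ℕ) :
    len a b n ≤ q + len a b ((dropDigit a b)^[q] n) := by
  by_contra! h
  have h1 := (lt_len_iff hab _ _).1 h
  rw [add_comm, Function.iterate_add_apply, ← lt_len_iff hab] at h1
  omega

theorem galoisConnection_leastLift {a b : ℕ} (hb : 0 < b) (ha : 0 < a) :
    GaloisConnection (leastLift a b) (dropDigit a b) := fun m n => by
  rw [leastLift, dropDigit, Nat.le_div_iff_mul_le ha, ← Nat.lt_succ_iff, Nat.div_lt_iff_lt_mul hb,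
    Nat.succ_mul, mul_comm m a, mul_comm b n]
  omega

theorem galoisConnection_iterate {a b : ℕ} (hb : 0 < b) (ha : 0 < a) (k : ℕ) :
    GaloisConnection (leastLift a b)^[k] (dropDigit a b)^[k] := by
  induction k with
  | zero => exact GaloisConnection.id
  | succ k ih =>
    rw [Function.iterate_succ, Function.iterate_succ']
    exact (galoisConnection_leastLift hb ha).compose ih

theorem leastLift_add_mul {a b : ℕ} (hb : 0 < b) (m t : ℕ) :
    leastLift a b (m + b * t) = leastLift a b m + a * t := by
  have : a * (m + b * t) + b - 1 = (a * m + b - 1) + b * (a * t) := by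
    have : a * (m + b * t) = a * m + b * (a * t) := by ring
    omega
  rw [leastLift, this, Nat.add_mul_div_left _ _ hb, leastLift]

theorem leastLift_iterate_add_mul {a b : ℕ} (hb : 0 < b) (k m t : ℕ) :
    (leastLift a b)^[k] (m + b ^ k * t) = (leastLift a b)^[k] m + a ^ k * t := by
  induction k generalizing m t with
  | zero => simp
  | succ k ih =>
    rw [Function.iterate_succ_apply, pow_succ', mul_assoc, leastLift_add_mul hb,
      mul_left_comm, ih, ← mul_assoc, ← pow_succ, Function.iterate_succ_apply]

/-- The constant `C = b / (a - b)`. With `θ = a / b`, the iterates of `leastLift` satisfy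
`θ ^ k * m ≤ leastLift^[k] m ≤ θ ^ k * (m + C)`. -/
noncomputable def liftError (a b : ℕ) : ℝ := b / ((a : ℝ) - b)

theorem liftError_nonneg {a b : ℕ} (hab : b < a) : 0 ≤ liftError a b := by
  have : (b : ℝ) < a := by exact_mod_cast hab
  exact div_nonneg (by positivity) (by linarith)

theorem pow_mul_le_leastLift_iterate {a b : ℕ} (hb : 0 < b) (k m : ℕ) :
    ((a : ℝ) / b) ^ k * m ≤ ((leastLift a b)^[k] m : ℕ) := by
  induction k with
  | zero => simp
  | succ k ih =>
    rw [Function.iterate_succ_apply']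
    set x := (leastLift a b)^[k] m
    have h : a * x ≤ b * leastLift a b x := by
      have := Nat.lt_mul_div_succ (a * x + b - 1) hb
      rw [← leastLift, mul_add] at this
      omega
    have h' : (a : ℝ) * x ≤ b * (leastLift a b x : ℕ) := by exact_mod_cast h
    have hb' : (0 : ℝ) < b := by exact_mod_cast hb
    calc ((a : ℝ) / b) ^ (k + 1) * m = (a : ℝ) / b * (((a : ℝ) / b) ^ k * m) := by ring
      _ ≤ (a : ℝ) / b * x := by gcongr
      _ ≤ _ := by rw [div_mul_eq_mul_div, div_le_iff₀ hb']; linarith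

theorem leastLift_iterate_le {a b : ℕ} (hb : 0 < b) (hab : b < a) (k m : ℕ) :
    ((leastLift a b)^[k] m : ℕ) ≤ ((a : ℝ) / b) ^ k * (m + liftError a b) := by
  have hb' : (0 : ℝ) < b := by exact_mod_cast hb
  have hab' : (b : ℝ) < a := by exact_mod_cast hab
  -- Adding the error constant on the left as well makes the induction close.
  suffices H : (((leastLift a b)^[k] m : ℕ) : ℝ) + liftError a b
      ≤ ((a : ℝ) / b) ^ k * (m + liftError a b) by
    linarith [liftError_nonneg hab]
  induction k with
  | zero => simp
  | succ k ih =>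
    rw [Function.iterate_succ_apply']
    set x := (leastLift a b)^[k] m
    have h : b * leastLift a b x ≤ a * x + b := by
      have := Nat.mul_div_le (a * x + b - 1) b
      rw [← leastLift] at this
      omega
    have h' : (b : ℝ) * (leastLift a b x : ℕ) ≤ a * x + b := by exact_mod_cast h
    have hC : (a : ℝ) * liftError a b = b * liftError a b + b := by
      have : (a : ℝ) - b ≠ 0 := by linarith
      rw [liftError]; field_simp; ring
    calc ((leastLift a b x : ℕ) : ℝ) + liftError a b
        ≤ (a : ℝ) / b * (x + liftError a b) := by
          rw [div_mul_eq_mul_div, le_div_iff₀ hb']; linarith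
      _ ≤ (a : ℝ) / b * (((a : ℝ) / b) ^ k * (m + liftError a b)) := by gcongr
      _ = _ := by ring

/-- The number of `n` that become `m` when their last `k` digits are deleted, as a real number.
By the Galois connection these `n` form the interval from `leastLift^[k] m` up to, but excluding,
`leastLift^[k] (m + 1)`. -/
noncomputable def fiberCard (a b k m : ℕ) : ℝ :=
  ((leastLift a b)^[k] (m + 1) : ℕ) - ((leastLift a b)^[k] m : ℕ)

theorem leastLift_iterate_mono {a b : ℕ} (hb : 0 < b) (hab : b < a) (k : ℕ) :
    Monotone (leastLift a b)^[k] := (galoisConnection_iterate hb (by omega) k).monotone_l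

theorem fiberCard_nonneg {a b : ℕ} (hb : 0 < b) (hab : b < a) (k m : ℕ) :
    0 ≤ fiberCard a b k m := by
  have : (leastLift a b)^[k] m ≤ (leastLift a b)^[k] (m + 1) :=
    leastLift_iterate_mono hb hab k (by omega)
  rw [fiberCard, sub_nonneg]; exact_mod_cast this

theorem fiberCard_le {a b : ℕ} (hb : 0 < b) (hab : b < a) (k m : ℕ) :
    fiberCard a b k m ≤ ((a : ℝ) / b) ^ k * (1 + liftError a b) := by
  have h1 := leastLift_iterate_le hb hab k (m + 1)
  have h2 := pow_mul_le_leastLift_iterate (a := a) hb k m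
  rw [fiberCard]; push_cast at h1 ⊢; nlinarith

/-- The fibre sizes at depth `k` are periodic with period `b ^ k`. -/
theorem fiberCard_add_mul {a b : ℕ} (hb : 0 < b) (k m t : ℕ) :
    fiberCard a b k (m + b ^ k * t) = fiberCard a b k m := by
  rw [fiberCard, fiberCard, add_right_comm, leastLift_iterate_add_mul hb,
    leastLift_iterate_add_mul hb]
  push_cast; ring

/-- Up to a relative error that decays geometrically in `j`, the fibre sizes at depth `i + j` are
those at depth `j`, rescaled. -/
theorem abs_fiberCard_add_sub_le {a b : ℕ} (hb : 0 < b) (hab : b < a) (i j m : ℕ) :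
    |fiberCard a b (i + j) m - ((a : ℝ) / b) ^ i * fiberCard a b j m|
      ≤ ((a : ℝ) / b) ^ i * liftError a b := by
  simp only [fiberCard, Function.iterate_add_apply]
  have h1 := leastLift_iterate_le hb hab i ((leastLift a b)^[j] (m + 1))
  have h2 := pow_mul_le_leastLift_iterate (a := a) hb i ((leastLift a b)^[j] (m + 1))
  have h3 := leastLift_iterate_le hb hab i ((leastLift a b)^[j] m)
  have h4 := pow_mul_le_leastLift_iterate (a := a) hb i ((leastLift a b)^[j] m)
  rw [abs_le]; constructor <;> nlinarith

theorem pow_mul_dropDigit_iterate_le {a b : ℕ} (hb : 0 < b) (hab : b < a) (k n : ℕ) :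
    ((a : ℝ) / b) ^ k * ((dropDigit a b)^[k] n : ℕ) ≤ n := by
  refine (pow_mul_le_leastLift_iterate (a := a) hb k _).trans ?_
  exact_mod_cast (galoisConnection_iterate hb (by omega) k).l_u_le n

theorem leastLift_iterate_zero {a b : ℕ} (hb : 0 < b) (k : ℕ) : (leastLift a b)^[k] 0 = 0 := by
  induction k with
  | zero => rfl
  | succ k ih =>
    rw [Function.iterate_succ_apply', ih, leastLift, Nat.div_eq_zero_iff]; omega

/-- Summing a function of `dropDigit^[k] j` over `j` amounts to a sum weighted by fibre sizes. -/
theorem sum_range_leastLift_iterate {a b : ℕ} (hb : 0 < b) (hab : b < a) (k : ℕ) (g : ℕ → ℝ)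
    (X : ℕ) :
    ∑ j ∈ Finset.range ((leastLift a b)^[k] X), g ((dropDigit a b)^[k] j)
      = ∑ m ∈ Finset.range X, g m * fiberCard a b k m := by
  have hgc := galoisConnection_iterate hb (by omega : 0 < a) k
  induction X with
  | zero => simp [leastLift_iterate_zero hb]
  | succ X ih =>
    have hle : (leastLift a b)^[k] X ≤ (leastLift a b)^[k] (X + 1) :=
      leastLift_iterate_mono hb hab k (by omega)
    rw [Finset.sum_range_succ, ← ih, ← Finset.sum_range_add_sum_Ico _ hle]
    congr 1
    rw [Finset.sum_congr rfl (g := fun _ => g X)]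
    · simp [fiberCard, Nat.cast_sub hle, mul_comm]
    · intro j hj
      rw [Finset.mem_Ico] at hj
      have h1 := (hgc _ _).1 hj.1
      have h2 := mt (hgc _ _).2 (not_le.2 hj.2)
      congr 1; omega

/-! ### Cancellation against periodic weights -/

/-- The indicator function of the residue class of `c` modulo `P`, minus its mean `1 / P`. -/
noncomputable def centred (P c m : ℕ) : ℝ := (if m ≡ c [MOD P] then 1 else 0) - 1 / (P : ℝ)

theorem abs_centred_le {P : ℕ} (hP : 0 < P) (c m : ℕ) : |centred P c m| ≤ 1 := by
  have h1 : (1 : ℝ) ≤ P := by exact_mod_cast hP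
  have h2 : 1 / (P : ℝ) ≤ 1 := by rw [div_le_one (by linarith)]; exact h1
  have h3 : 0 ≤ 1 / (P : ℝ) := by positivity
  rw [centred, abs_le]
  split_ifs <;> constructor <;> linarith

theorem centred_add_mul (P c m t : ℕ) : centred P c (m + P * t) = centred P c m := by
  have h : m + P * t ≡ c [MOD P] ↔ m ≡ c [MOD P] := by simp [Nat.ModEq]
  simp only [centred, h]

/-- The residues of `i + Q * t` for `t < P` run through all classes modulo `P` once. -/
theorem sum_centred_progression {P Q : ℕ} (hP : 0 < P) (hPQ : P.Coprime Q) (c i : ℕ) :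
    ∑ t ∈ Finset.range P, centred P c (i + Q * t) = 0 := by
  have : NeZero P := ⟨hP.ne'⟩
  obtain ⟨u, hu⟩ := (ZMod.isUnit_iff_coprime Q P).2 hPQ.symm
  set t₀ : ZMod P := (↑u⁻¹ : ZMod P) * (c - i) with ht₀
  have key : ∀ t ∈ Finset.range P, (if i + Q * t ≡ c [MOD P] then (1 : ℝ) else 0)
      = if t = t₀.val then 1 else 0 := by
    intro t ht
    have hiff : i + Q * t ≡ c [MOD P] ↔ t = t₀.val := by
      rw [← ZMod.natCast_eq_natCast_iff]
      push_cast
      rw [← hu]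
      constructor
      · intro h
        have : (t : ZMod P) = t₀ := by
          rw [ht₀, ← h]; simp
        rw [← this, ZMod.val_cast_of_lt (Finset.mem_range.1 ht)]
      · rintro rfl
        simp [ht₀]
    simp only [hiff]
  have hP' : (P : ℝ) ≠ 0 := by positivity
  simp only [centred, Finset.sum_sub_distrib]
  rw [Finset.sum_congr rfl key, Finset.sum_ite_eq', if_pos (Finset.mem_range.2 (ZMod.val_lt _))]
  simp [hP']

theorem sum_range_mul_eq (h : ℕ → ℝ) (Q q : ℕ) :
    ∑ m ∈ Finset.range (Q * q), h m
      = ∑ t ∈ Finset.range q, ∑ i ∈ Finset.range Q, h (i + Q * t) := by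
  induction q with
  | zero => simp
  | succ q ih =>
    rw [mul_add_one, Finset.sum_range_add, ih, Finset.sum_range_succ]
    simp only [add_comm]

theorem abs_sum_range_le_of_periodic {h : ℕ → ℝ} {L : ℕ} {B : ℝ} (hL : 0 < L)
    (hper : ∀ m t, h (m + L * t) = h m) (hsum : ∑ m ∈ Finset.range L, h m = 0)
    (hB : ∀ m, |h m| ≤ B) (X : ℕ) : |∑ m ∈ Finset.range X, h m| ≤ L * B := by
  have hB0 : 0 ≤ B := (abs_nonneg _).trans (hB 0)
  rw [← Nat.div_add_mod X L, Finset.sum_range_add, sum_range_mul_eq]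
  simp only [hper, hsum, Finset.sum_const_zero, zero_add]
  refine (Finset.abs_sum_le_sum_abs _ _).trans ((Finset.sum_le_card_nsmul _ _ B
    fun i _ => hB _).trans ?_)
  rw [Finset.card_range, nsmul_eq_mul]
  have : (X % L : ℕ) ≤ (L : ℝ) := by exact_mod_cast (Nat.mod_lt X hL).le
  gcongr

/-- A weight whose period is coprime to `P` does not correlate with residue classes modulo `P`:
over a full period the two are independent, by the Chinese remainder theorem. -/
theorem abs_sum_centred_mul_le {P Q : ℕ} (hP : 0 < P) (hQ : 0 < Q) (hPQ : P.Coprime Q) (c : ℕ)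
    {e : ℕ → ℝ} {B : ℝ} (hper : ∀ m t, e (m + Q * t) = e m) (hB : ∀ m, |e m| ≤ B) (X : ℕ) :
    |∑ m ∈ Finset.range X, centred P c m * e m| ≤ P * Q * B := by
  have := abs_sum_range_le_of_periodic (h := fun m => centred P c m * e m) (L := Q * P) (B := B)
    (Nat.mul_pos hQ hP) (fun m t => ?_) ?_ (fun m => ?_) X
  · refine this.trans_eq ?_; push_cast; ring
  · have h1 : m + Q * P * t = m + P * (Q * t) := by ring
    have h2 : m + Q * P * t = m + Q * (P * t) := by ring
    rw [h1, centred_add_mul, ← h1, h2, hper]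
  · rw [sum_range_mul_eq, Finset.sum_comm]
    refine Finset.sum_eq_zero fun i _ => ?_
    simp only [hper, ← Finset.sum_mul]
    rw [sum_centred_progression hP hPQ, zero_mul]
  · rw [abs_mul]
    have := mul_le_mul (abs_centred_le hP c m) (hB m) (abs_nonneg _) zero_le_one
    linarith

/-! ### Equidistribution of truncated integers in residue classes -/

/-- The discrepancy of the weighted sum over `m < X` is at most a constant depending on the cut-off
`J`, plus a proportion of `X` that tends to `0` as `J` grows, all in units of `(a/b)^k`. -/
theorem abs_sum_centred_mul_fiberCard_le {a b P : ℕ} (hb : 0 < b) (hab : b < a) (hP : 0 < P)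
    (hPb : P.Coprime b) (c J k X : ℕ) :
    |∑ m ∈ Finset.range X, centred P c m * fiberCard a b k m|
      ≤ ((a : ℝ) / b) ^ k * (P * b ^ J * (1 + liftError a b)
        + ((b : ℝ) / a) ^ J * liftError a b * X) := by
  have hb' : (0 : ℝ) < b := by exact_mod_cast hb
  have ha' : (0 : ℝ) < a := by exact_mod_cast (by omega : 0 < a)
  have hC := liftError_nonneg hab
  have base : ∀ j, |∑ m ∈ Finset.range X, centred P c m * fiberCard a b j m|
      ≤ P * (b ^ j : ℕ) * (((a : ℝ) / b) ^ j * (1 + liftError a b)) := fun j =>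
    abs_sum_centred_mul_le hP (pow_pos hb j) (hPb.pow_right j) c
      (fun m t => fiberCard_add_mul hb j m t)
      (fun m => by rw [abs_of_nonneg (fiberCard_nonneg hb hab j m)]
                   exact fiberCard_le hb hab j m) X
  -- Periodicity is used at depth `min k J`, so that the period stays bounded by `b ^ J`.
  rcases le_total k J with hk | hk
  · refine (base k).trans ?_
    have h1 : (b : ℝ) ^ k ≤ b ^ J := pow_le_pow_right₀ (by exact_mod_cast hb) hk
    have h2 : 0 ≤ ((a : ℝ) / b) ^ k * (((b : ℝ) / a) ^ J * liftError a b * X) := by positivity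
    have h3 : (P : ℝ) * (b ^ k : ℕ) * (((a : ℝ) / b) ^ k * (1 + liftError a b))
        ≤ P * b ^ J * (((a : ℝ) / b) ^ k * (1 + liftError a b)) := by
      push_cast; gcongr
    nlinarith
  · obtain ⟨i, rfl⟩ := Nat.exists_eq_add_of_le' hk
    have hsplit : ∑ m ∈ Finset.range X, centred P c m * fiberCard a b (i + J) m
        = ((a : ℝ) / b) ^ i * ∑ m ∈ Finset.range X, centred P c m * fiberCard a b J m
          + ∑ m ∈ Finset.range X, centred P c m *
            (fiberCard a b (i + J) m - ((a : ℝ) / b) ^ i * fiberCard a b J m) := by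
      rw [Finset.mul_sum, ← Finset.sum_add_distrib]
      exact Finset.sum_congr rfl fun m _ => by ring
    have h2 : |∑ m ∈ Finset.range X, centred P c m *
        (fiberCard a b (i + J) m - ((a : ℝ) / b) ^ i * fiberCard a b J m)|
        ≤ X * (((a : ℝ) / b) ^ i * liftError a b) := by
      refine (Finset.abs_sum_le_sum_abs _ _).trans ((Finset.sum_le_card_nsmul _ _
        (((a : ℝ) / b) ^ i * liftError a b) fun m _ => ?_).trans_eq ?_)
      · rw [abs_mul]
        have := mul_le_mul (abs_centred_le hP c m) (abs_fiberCard_add_sub_le hb hab i J m)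
          (abs_nonneg _) zero_le_one
        linarith
      · simp
    have h3 : ((a : ℝ) / b) ^ (i + J) * ((b : ℝ) / a) ^ J = ((a : ℝ) / b) ^ i := by
      rw [pow_add, mul_assoc, ← mul_pow, div_mul_div_cancel₀ hb'.ne', div_self ha'.ne', one_pow,
        mul_one]
    rw [hsplit]
    refine (abs_add_le _ _).trans ?_
    rw [abs_mul, abs_of_nonneg (by positivity : (0 : ℝ) ≤ ((a : ℝ) / b) ^ i)]
    calc _ ≤ ((a : ℝ) / b) ^ i * (P * (b ^ J : ℕ) * (((a : ℝ) / b) ^ J * (1 + liftError a b)))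
          + X * (((a : ℝ) / b) ^ i * liftError a b) := by
          gcongr; exact base J
      _ = ((a : ℝ) / b) ^ (i + J) * (P * b ^ J * (1 + liftError a b))
          + (((a : ℝ) / b) ^ (i + J) * ((b : ℝ) / a) ^ J) * (liftError a b * X) := by
          rw [h3]; push_cast; ring
      _ = _ := by ring

/-- The function `centred`, with the value at `0` replaced by `0`, so that the vanishing
truncations of a number do not contribute. -/
noncomputable def centredPos (P c m : ℕ) : ℝ := if m = 0 then 0 else centred P c m

theorem abs_centredPos_le {P : ℕ} (hP : 0 < P) (c m : ℕ) : |centredPos P c m| ≤ 1 := by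
  rw [centredPos]; split_ifs
  · simp
  · exact abs_centred_le hP c m

/-- The discrepancy of the truncations at depth `k` of the numbers below `n`. The `2` in the bound
accounts for the fibre over `0` and for the last, incomplete fibre. -/
theorem abs_sum_centredPos_dropDigit_le {a b P : ℕ} (hb : 0 < b) (hab : b < a) (hP : 0 < P)
    (hPb : P.Coprime b) (c J k n : ℕ) :
    |∑ j ∈ Finset.range n, centredPos P c ((dropDigit a b)^[k] j)|
      ≤ ((a : ℝ) / b) ^ k * ((P * b ^ J + 2) * (1 + liftError a b))
        + ((b : ℝ) / a) ^ J * liftError a b * n := by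
  have hgc := galoisConnection_iterate hb (by omega : 0 < a) k
  have hC := liftError_nonneg hab
  set X := (dropDigit a b)^[k] n with hX
  have hle : (leastLift a b)^[k] X ≤ n := hgc.l_u_le n
  have hlt : n < (leastLift a b)^[k] (X + 1) := by
    by_contra! h
    have := (hgc _ _).1 h
    omega
  have hsplit := Finset.sum_range_add_sum_Ico
    (fun j => centredPos P c ((dropDigit a b)^[k] j)) hle
  have h1 : |∑ m ∈ Finset.range X, (centredPos P c m - centred P c m) * fiberCard a b k m|
      ≤ ((a : ℝ) / b) ^ k * (1 + liftError a b) := by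
    rcases Nat.eq_zero_or_pos X with h0 | h0
    · rw [h0]; simp; positivity
    · rw [Finset.sum_eq_single_of_mem 0 (Finset.mem_range.2 h0)
        (fun m _ hm => by simp [centredPos, hm])]
      rw [abs_mul, abs_of_nonneg (fiberCard_nonneg hb hab k 0)]
      have := mul_le_mul (abs_centred_le hP c 0) (fiberCard_le hb hab k 0)
        (fiberCard_nonneg hb hab k 0) zero_le_one
      simpa [centredPos] using this
  have h2 : |∑ j ∈ Finset.Ico ((leastLift a b)^[k] X) n, centredPos P c ((dropDigit a b)^[k] j)|
      ≤ ((a : ℝ) / b) ^ k * (1 + liftError a b) := by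
    refine (Finset.abs_sum_le_sum_abs _ _).trans ((Finset.sum_le_card_nsmul _ _ 1
      fun m _ => abs_centredPos_le hP c _).trans (le_trans ?_ (fiberCard_le hb hab k X)))
    rw [Nat.card_Ico, nsmul_eq_mul, mul_one, fiberCard, Nat.cast_sub hle]
    have : (n : ℝ) ≤ ((leastLift a b)^[k] (X + 1) : ℕ) := by exact_mod_cast hlt.le
    linarith
  have h3 := abs_sum_centred_mul_fiberCard_le hb hab hP hPb c J k X
  have h4 : ((a : ℝ) / b) ^ k * X ≤ n := pow_mul_dropDigit_iterate_le hb hab k n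
  have h5 : ((b : ℝ) / a) ^ J * liftError a b * (((a : ℝ) / b) ^ k * X)
      ≤ ((b : ℝ) / a) ^ J * liftError a b * n := by gcongr
  rw [← hsplit, sum_range_leastLift_iterate hb hab k (centredPos P c)]
  have h6 : ∑ m ∈ Finset.range X, centredPos P c m * fiberCard a b k m
      = ∑ m ∈ Finset.range X, (centredPos P c m - centred P c m) * fiberCard a b k m
        + ∑ m ∈ Finset.range X, centred P c m * fiberCard a b k m := by
    rw [← Finset.sum_add_distrib]; exact Finset.sum_congr rfl fun m _ => by ring
  rw [h6]
  refine (abs_add_le _ _).trans ((add_le_add_left (abs_add_le _ _) _).trans ?_)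
  nlinarith

/-- The length of `n` is at most `1 + log n / log (a / b)`. -/
theorem pow_len_le {a b : ℕ} (hb : 0 < b) (hab : b < a) {n : ℕ} (hn : 0 < n) :
    ((a : ℝ) / b) ^ len a b n ≤ (a : ℝ) / b * n := by
  obtain ⟨l, hl⟩ := Nat.exists_eq_add_of_lt (len_pos hab hn)
  rw [zero_add] at hl
  have h1 : 0 < (dropDigit a b)^[l] n := (lt_len_iff hab _ _).1 (by omega)
  have h2 : (1 : ℝ) ≤ ((dropDigit a b)^[l] n : ℕ) := by exact_mod_cast h1
  have h3 := pow_mul_dropDigit_iterate_le hb hab l n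
  have h4 : ((a : ℝ) / b) ^ l ≤ n := le_trans (le_mul_of_one_le_right (by positivity) h2) h3
  rw [hl, pow_succ']; gcongr

/-- The discrepancies at the individual depths `k`, summed. The terms of size `(a/b)^k` form a
geometric sum bounded by a multiple of `n`, because `(a/b)^(len n)` is at most `(a/b) * n`. -/
theorem exists_abs_sum_sum_centred_le {a b P : ℕ} (hb : 0 < b) (hab : b < a) (hP : 0 < P)
    (hPb : P.Coprime b) (c J : ℕ) :
    ∃ K : ℝ, ∀ n : ℕ,
      |∑ j ∈ Finset.range n, ∑ k ∈ Finset.range (len a b j), centred P c ((dropDigit a b)^[k] j)|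
        ≤ K * n + ((b : ℝ) / a) ^ J * liftError a b * (n * len a b n) := by
  have hb' : (0 : ℝ) < b := by exact_mod_cast hb
  have hab' : (b : ℝ) < a := by exact_mod_cast hab
  have hC := liftError_nonneg hab
  have hθ : 1 < (a : ℝ) / b := by rwa [one_lt_div hb']
  set θ := (a : ℝ) / b
  set D := (P * (b : ℝ) ^ J + 2) * (1 + liftError a b) with hD
  have hD0 : 0 ≤ D := by positivity
  have hθ0 : 0 < θ - 1 := by linarith
  refine ⟨θ / (θ - 1) * D, fun n => ?_⟩
  rcases Nat.eq_zero_or_pos n with rfl | hn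
  · simp
  have hswap : ∑ j ∈ Finset.range n, ∑ k ∈ Finset.range (len a b j),
      centred P c ((dropDigit a b)^[k] j)
      = ∑ k ∈ Finset.range (len a b n), ∑ j ∈ Finset.range n,
        centredPos P c ((dropDigit a b)^[k] j) := by
    rw [Finset.sum_comm (s := Finset.range (len a b n))]
    refine Finset.sum_congr rfl fun j hj => ?_
    have hjl : len a b j ≤ len a b n := len_mono hab (Finset.mem_range.1 hj).le
    rw [← Finset.sum_range_add_sum_Ico _ hjl, Finset.sum_eq_zero (s := Finset.Ico _ _), add_zero]
    · refine Finset.sum_congr rfl fun k hk => ?_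
      have := (lt_len_iff hab _ _).1 (Finset.mem_range.1 hk)
      rw [centredPos, if_neg this.ne']
    · intro k hk
      have := mt (lt_len_iff hab _ _).2 (not_lt.2 (Finset.mem_Ico.1 hk).1)
      rw [centredPos, if_pos (by omega)]
  rw [hswap]
  calc _ ≤ ∑ k ∈ Finset.range (len a b n),
        (θ ^ k * D + ((b : ℝ) / a) ^ J * liftError a b * n) :=
        (Finset.abs_sum_le_sum_abs _ _).trans (Finset.sum_le_sum fun k _ =>
          abs_sum_centredPos_dropDigit_le hb hab hP hPb c J k n)
    _ = (θ ^ len a b n - 1) / (θ - 1) * D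
        + ((b : ℝ) / a) ^ J * liftError a b * (n * len a b n) := by
        rw [Finset.sum_add_distrib, ← Finset.sum_mul, geom_sum_eq hθ.ne']
        simp; ring
    _ ≤ (θ * n) / (θ - 1) * D + ((b : ℝ) / a) ^ J * liftError a b * (n * len a b n) := by
        have := pow_len_le hb hab hn
        gcongr; linarith
    _ = _ := by ring

/-! ### The concatenation of the representations -/

theorem offset_succ (a b n : ℕ) : offset a b (n + 1) = offset a b n + len a b n := by
  rcases Nat.eq_zero_or_pos n with rfl | hn
  · simp [offset, len_zero]
  · rw [offset, Finset.sum_Ico_succ_top hn, offset]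

theorem offset_mono (a b : ℕ) : Monotone (offset a b) :=
  monotone_nat_of_le_succ fun n => by rw [offset_succ]; omega

theorem le_offset_succ {a b : ℕ} (hab : b < a) (n : ℕ) : n ≤ offset a b (n + 1) := by
  induction n with
  | zero => omega
  | succ n ih =>
    rw [offset_succ]
    have : 0 < len a b (n + 1) := len_pos hab n.succ_pos
    omega

/-- The number whose representation covers position `N` of the concatenation. -/
def blockIndex (a b N : ℕ) : ℕ := Nat.findGreatest (fun n => offset a b n ≤ N) (N + 1)

theorem offset_blockIndex_le (a b N : ℕ) : offset a b (blockIndex a b N) ≤ N :=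
  Nat.findGreatest_spec (P := fun n => offset a b n ≤ N) (Nat.zero_le (N + 1)) (by simp [offset])

theorem lt_offset_blockIndex_succ {a b : ℕ} (hab : b < a) (N : ℕ) :
    N < offset a b (blockIndex a b N + 1) := by
  by_contra! h
  rcases Nat.lt_or_ge (N + 1) (blockIndex a b N + 1) with h1 | h1
  · have h2 := le_offset_succ hab (blockIndex a b N)
    omega
  · have : blockIndex a b N + 1 ≤ blockIndex a b N := Nat.le_findGreatest h1 h
    omega

theorem blockIndex_offset_add {a b n k : ℕ} (hab : b < a) (hk : k < len a b n) :
    blockIndex a b (offset a b n + k) = n := by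
  have h1 := offset_blockIndex_le a b (offset a b n + k)
  have h2 := lt_offset_blockIndex_succ hab (offset a b n + k)
  have h3 := offset_succ a b n
  apply le_antisymm
  · by_contra! h
    have : offset a b (n + 1) ≤ _ := offset_mono a b h
    omega
  · by_contra! h
    have : offset a b (blockIndex a b (offset a b n + k) + 1) ≤ offset a b n :=
      offset_mono a b h
    omega

/-- The concatenation of the base-`a/b` representations of `1, 2, 3, …`, each with its most
significant digit first, as a sequence of digits. -/
def concat (a b : ℕ) [NeZero a] (N : ℕ) : Fin a :=
  Fin.ofNat a (digit a b (len a b (blockIndex a b N) - 1 - (N - offset a b (blockIndex a b N)))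
    (blockIndex a b N))

theorem concat_offset_add {a b : ℕ} [NeZero a] {n k : ℕ} (hab : b < a) (hk : k < len a b n) :
    (concat a b (offset a b n + k) : ℕ) = digit a b (len a b n - 1 - k) n := by
  rw [concat, blockIndex_offset_add hab hk, Nat.add_sub_cancel_left, Fin.val_ofNat, digit_eq hab,
    Nat.mod_mod]

theorem sum_range_offset {M : Type*} [AddCommMonoid M] (a b : ℕ) (f : ℕ → M) (n : ℕ) :
    ∑ p ∈ Finset.range (offset a b n), f p
      = ∑ j ∈ Finset.range n, ∑ i ∈ Finset.range (len a b j), f (offset a b j + i) := by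
  induction n with
  | zero => simp [offset]
  | succ n ih => rw [offset_succ, Finset.sum_range_add, ih, Finset.sum_range_succ]

theorem tendsto_offset_succ {a b : ℕ} (hab : b < a) :
    Tendsto (fun n => offset a b (n + 1)) atTop atTop :=
  tendsto_atTop_mono (le_offset_succ hab) tendsto_id

theorem champernowne_eq_ofDigits {a b : ℕ} [NeZero a] (hab : b < a) :
    champernowne a b = Real.ofDigits (concat a b) := by
  rw [champernowne, Real.ofDigits]
  refine HasSum.tsum_eq ?_
  rw [hasSum_iff_tendsto_nat_of_nonneg (fun n => by positivity)]
  refine ((Real.summable_ofDigitsTerm (digits := concat a b)).hasSum.tendsto_sum_nat.comp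
    (tendsto_offset_succ hab)).congr fun n => ?_
  rw [Function.comp_apply, sum_range_offset, Finset.sum_range_succ', len_zero, Finset.sum_range_zero,
    add_zero]
  refine Finset.sum_congr rfl fun j _ => ?_
  rw [← Finset.Ico_add_one_right_eq_Icc, Finset.sum_Ico_eq_sum_range, Nat.add_sub_cancel]
  refine Finset.sum_congr rfl fun i hi => ?_
  rw [Real.ofDigitsTerm, concat_offset_add hab (Finset.mem_range.1 hi), div_eq_mul_inv,
    Nat.sub_sub, show 1 + i + offset a b (j + 1) = offset a b (j + 1) + i + 1 by omega]

/-! ### Recovering the digits from the number -/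

theorem ofDigits_lt_one {a : ℕ} {z : ℕ → Fin a} (ha : 1 < a) (h : ∃ i, (z i : ℕ) ≠ a - 1) :
    Real.ofDigits z < 1 := by
  obtain ⟨i, hi⟩ := h
  have ha0 : (0 : ℝ) < a := by exact_mod_cast (by omega : 0 < a)
  have hle : ∀ i, (z i : ℕ) ≤ a - 1 := fun i => by have := (z i).isLt; omega
  rw [← Real.ofDigits_const_last_eq_one' ha]
  refine Summable.tsum_lt_tsum (i := i) (fun j => ?_) ?_ Real.summable_ofDigitsTerm
    Real.summable_ofDigitsTerm
  · have : ((z j : ℕ) : ℝ) ≤ ((a - 1 : ℕ) : ℝ) := by exact_mod_cast hle j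
    simp only [Real.ofDigitsTerm]; gcongr
  · have : ((z i : ℕ) : ℝ) < ((a - 1 : ℕ) : ℝ) := by
      exact_mod_cast lt_of_le_of_ne (hle i) hi
    simp only [Real.ofDigitsTerm]; gcongr

/-- A digit sequence that does not end in a constant run of the largest digit is the standard
expansion of its value. -/
theorem digits_ofDigits {a : ℕ} [NeZero a] {z : ℕ → Fin a} (ha : 1 < a)
    (h : ∀ n, ∃ i ≥ n, (z i : ℕ) ≠ a - 1) : Real.digits (Real.ofDigits z) a = z := by
  have ha0 : (a : ℝ) ≠ 0 := by exact_mod_cast (by omega : a ≠ 0)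
  have hint : ∀ n, ∃ M : ℕ, (a : ℝ) ^ n * ∑ i ∈ Finset.range n, Real.ofDigitsTerm z i = M := by
    intro n
    induction n with
    | zero => exact ⟨0, by simp⟩
    | succ n ih =>
      obtain ⟨M, hM⟩ := ih
      refine ⟨a * M + z n, ?_⟩
      rw [Finset.sum_range_succ, mul_add, pow_succ', mul_assoc, hM, Real.ofDigitsTerm, pow_succ']
      push_cast
      field_simp
  funext n
  obtain ⟨M, hM⟩ := hint n
  have htail : Real.ofDigits (fun i => z (i + (n + 1))) < 1 := by
    obtain ⟨i, hi, hz⟩ := h (n + 1)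
    exact ofDigits_lt_one ha ⟨i - (n + 1), by rwa [Nat.sub_add_cancel hi]⟩
  have htail0 := Real.ofDigits_nonneg (fun i => z (i + (n + 1)))
  have hval : Real.ofDigits z * (a : ℝ) ^ (n + 1)
      = ((a * M + z n : ℕ) : ℝ) + Real.ofDigits (fun i => z (i + (n + 1))) := by
    rw [Real.ofDigits_eq_sum_add_ofDigits z (n + 1), Finset.sum_range_succ, Real.ofDigitsTerm]
    push_cast
    rw [← hM]
    field_simp
    ring
  have hfloor : ⌊Real.ofDigits z * (a : ℝ) ^ (n + 1)⌋₊ = a * M + z n := by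
    rw [Nat.floor_eq_iff (by rw [hval]; positivity), hval]
    constructor <;> linarith
  apply Fin.ext
  rw [Real.digits, hfloor, Fin.val_ofNat, Nat.mul_add_mod, Nat.mod_eq_of_lt (z n).isLt]

/-- The representation of every multiple of `a` ends in the digit `0`. -/
theorem exists_concat_ne {a b : ℕ} [NeZero a] (hab : b < a) (ha : 1 < a) (n : ℕ) :
    ∃ i ≥ n, (concat a b i : ℕ) ≠ a - 1 := by
  have hpos : 0 < a * (n + 1) := Nat.mul_pos (by omega) n.succ_pos
  have hl := len_pos hab hpos
  refine ⟨offset a b (a * (n + 1)) + (len a b (a * (n + 1)) - 1), ?_, ?_⟩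
  · have h1 := le_offset_succ hab (a * (n + 1))
    rw [offset_succ] at h1
    have h2 : 1 * (n + 1) ≤ a * (n + 1) := Nat.mul_le_mul_right _ ha.le
    omega
  · rw [concat_offset_add hab (by omega), digit_eq hab, Nat.sub_self, Function.iterate_zero, id,
      mul_left_comm, Nat.mul_mod_right]
    omega

theorem champernowne_mem_Ioo {a b : ℕ} [NeZero a] (hb : 0 < b) (hab : b < a) :
    champernowne a b ∈ Set.Ioo (0 : ℝ) 1 := by
  rw [champernowne_eq_ofDigits hab]
  constructor
  · refine Real.summable_ofDigitsTerm.tsum_pos (fun _ => Real.ofDigitsTerm_nonneg) 0 ?_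
    have hl := len_pos hab one_pos
    have h0 : 0 = offset a b 1 + 0 := by simp [offset]
    have hlen : len a b 1 = 1 := by
      rw [len_of_pos one_pos hab, dropDigit, mul_one, Nat.div_eq_of_lt hab, len_zero]
    rw [Real.ofDigitsTerm, h0, concat_offset_add hab hl, hlen, digit_eq hab]
    simp only [Nat.sub_self, Function.iterate_zero, id, mul_one, Nat.mod_eq_of_lt hab]
    have : (0 : ℝ) < a := by exact_mod_cast (by omega : 0 < a)
    positivity
  · obtain ⟨i, _, hi⟩ := exists_concat_ne hab (by omega) 0
    exact ofDigits_lt_one (by omega) ⟨i, hi⟩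

theorem digits_champernowne {a b : ℕ} [NeZero a] (hb : 0 < b) (hab : b < a) :
    Real.digits (champernowne a b) a = concat a b := by
  rw [champernowne_eq_ofDigits hab]
  exact digits_ofDigits (by omega) (exists_concat_ne hab (by omega))

/-! ### Occurrences of a word -/

/-- Prescribing the last `r` digits of a number amounts to prescribing its residue modulo
`a ^ r`. -/
theorem exists_residue {a b : ℕ} (hab : b < a) (hco : a.Coprime b) (r : ℕ) (d : ℕ → ℕ)
    (hd : ∀ i < r, d i < a) :
    ∃ c, ∀ m, (∀ i < r, b * (dropDigit a b)^[i] m % a = d i) ↔ m ≡ c [MOD a ^ r] := by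
  induction r generalizing d with
  | zero => exact ⟨0, fun m => by simp [Nat.modEq_one]⟩
  | succ r ih =>
    obtain ⟨c', hc'⟩ := ih (fun i => d (i + 1)) fun i hi => hd _ (by omega)
    have ha : 0 < a := by omega
    have hd0 := hd 0 (by omega)
    have : NeZero (a ^ (r + 1)) := ⟨(pow_pos ha _).ne'⟩
    have hcop : b.Coprime (a ^ (r + 1)) := (hco.pow_left _).symm
    obtain ⟨u, hu⟩ := (ZMod.isUnit_iff_coprime b (a ^ (r + 1))).2 hcop
    obtain ⟨c, hc⟩ : ∃ c : ℕ, b * c ≡ d 0 + a * c' [MOD a ^ (r + 1)] := by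
      refine ⟨((↑u⁻¹ : ZMod (a ^ (r + 1))) * ((d 0 + a * c' : ℕ) : ZMod _)).val, ?_⟩
      rw [← ZMod.natCast_eq_natCast_iff, Nat.cast_mul, ZMod.natCast_zmod_val, ← hu,
        Units.mul_inv_cancel_left]
    refine ⟨c, fun m => ?_⟩
    have hm : b * m % a + a * dropDigit a b m = b * m := Nat.mod_add_div _ _
    have h1 : (∀ i < r + 1, b * (dropDigit a b)^[i] m % a = d i)
        ↔ b * m % a = d 0 ∧ dropDigit a b m ≡ c' [MOD a ^ r] := by
      rw [← hc', Nat.forall_lt_succ_left']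
      simp [Function.iterate_succ_apply]
    have h2 : m ≡ c [MOD a ^ (r + 1)] ↔ b * m ≡ d 0 + a * c' [MOD a ^ (r + 1)] :=
      ⟨fun h => (h.mul_left b).trans hc, fun h =>
        Nat.ModEq.cancel_left_of_coprime hcop.symm (h.trans hc.symm)⟩
    rw [h1, h2]
    constructor
    · rintro ⟨h3, h4⟩
      rw [← hm, h3, pow_succ']
      exact (h4.mul_left' a).add_left _
    · intro h
      have h3 : b * m % a = d 0 := by
        have := h.of_dvd (dvd_pow_self a r.succ_ne_zero)
        rw [Nat.ModEq, Nat.add_mul_mod_self_left, Nat.mod_eq_of_lt hd0] at this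
        exact this
      refine ⟨h3, ?_⟩
      rw [← hm, h3, pow_succ'] at h
      exact Nat.ModEq.mul_left_cancel' ha.ne' (Nat.ModEq.add_left_cancel' _ h)

/-- The word `w` occurs in `z` at position `p`. -/
def OccursAt {a : ℕ} (z : ℕ → Fin a) (w : List (Fin a)) (p : ℕ) : Prop :=
  ∀ i : Fin w.length, z (p + i) = w.get i

/-- An occurrence of a word inside the representation of a single number `n` is a residue condition
on a truncation of `n`. Here `q` counts the positions at which the word fits. -/
theorem exists_residue_occursAt {a b : ℕ} [NeZero a] (hab : b < a) (hco : a.Coprime b)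
    (w : List (Fin a)) :
    ∃ c, ∀ n q i, len a b n + 1 = q + w.length → i < q →
      (OccursAt (concat a b) w (offset a b n + i)
        ↔ (dropDigit a b)^[q - 1 - i] n ≡ c [MOD a ^ w.length]) := by
  obtain ⟨c, hc⟩ := exists_residue hab hco w.length
    (fun i => (w.getD (w.length - 1 - i) 0 : Fin a)) fun i _ => Fin.isLt _
  refine ⟨c, fun n q i hq hi => ?_⟩
  rw [← hc]
  have key : ∀ t < w.length, (concat a b (offset a b n + i + t) : ℕ)
      = b * (dropDigit a b)^[w.length - 1 - t] ((dropDigit a b)^[q - 1 - i] n) % a := by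
    intro t ht
    rw [add_assoc, concat_offset_add hab (by omega), digit_eq hab, ← Function.iterate_add_apply]
    congr 4; omega
  constructor
  · intro h u hu
    have h1 := key (w.length - 1 - u) (by omega)
    rw [h ⟨w.length - 1 - u, by omega⟩,
      show w.length - 1 - (w.length - 1 - u) = u by omega] at h1
    rw [← h1, List.getD_eq_getElem _ _ (by omega)]
    rfl
  · intro h t
    have h1 := h (w.length - 1 - t) (by have := t.isLt; omega)
    rw [← key t t.isLt, show w.length - 1 - (w.length - 1 - (t : ℕ)) = t by
      have := t.isLt; omega, List.getD_eq_getElem _ _ t.isLt] at h1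
    exact Fin.ext h1

open Classical in
/-- The indicator of an occurrence of `w` in the concatenation, minus its expected mean. -/
noncomputable def centredOcc (a b : ℕ) [NeZero a] (w : List (Fin a)) (p : ℕ) : ℝ :=
  (if OccursAt (concat a b) w p then 1 else 0) - 1 / (a : ℝ) ^ w.length

theorem abs_centredOcc_le (a b : ℕ) [NeZero a] (w : List (Fin a)) (p : ℕ) :
    |centredOcc a b w p| ≤ 1 := by
  have h0 : (1 : ℝ) ≤ a := by exact_mod_cast NeZero.one_le
  have h1 : (1 : ℝ) ≤ (a : ℝ) ^ w.length := one_le_pow₀ h0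
  have h2 : 1 / (a : ℝ) ^ w.length ≤ 1 := by rw [div_le_one (by linarith)]; exact h1
  have h3 : 0 ≤ 1 / (a : ℝ) ^ w.length := by positivity
  rw [centredOcc, abs_le]
  split_ifs <;> constructor <;> linarith

theorem abs_sum_range_le_card {f : ℕ → ℝ} (hf : ∀ i, |f i| ≤ 1) (n : ℕ) :
    |∑ i ∈ Finset.range n, f i| ≤ n :=
  (Finset.abs_sum_le_sum_abs _ _).trans ((Finset.sum_le_card_nsmul _ _ 1 fun i _ => hf i).trans_eq
    (by simp))

/-- The two sides differ only at the fewer than `w.length` positions near the end of the block where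
the word overlaps the next block, and in the leading truncations of `n`. -/
theorem exists_abs_sum_block_sub_le {a b : ℕ} [NeZero a] (hab : b < a) (hco : a.Coprime b)
    {w : List (Fin a)} (hw : w ≠ []) :
    ∃ c, ∀ n, |∑ i ∈ Finset.range (len a b n), centredOcc a b w (offset a b n + i)
      - ∑ k ∈ Finset.range (len a b n), centred (a ^ w.length) c ((dropDigit a b)^[k] n)|
        ≤ 2 * w.length := by
  obtain ⟨c, hc⟩ := exists_residue_occursAt hab hco w
  refine ⟨c, fun n => ?_⟩
  have hr : 0 < w.length := List.length_pos_iff.2 hw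
  have hP : 0 < a ^ w.length := pow_pos (NeZero.pos a) _
  have bound : ∀ {f g : ℕ → ℝ}, (∀ i, |f i| ≤ 1) → (∀ i, |g i| ≤ 1) → ∀ m : ℕ, m ≤ w.length →
      |∑ i ∈ Finset.range m, f i - ∑ i ∈ Finset.range m, g i| ≤ 2 * w.length := by
    intro f g hf hg m hm
    have h1 := abs_sum_range_le_card hf m
    have h2 := abs_sum_range_le_card hg m
    have h3 : (m : ℝ) ≤ w.length := by exact_mod_cast hm
    have h4 := abs_sub (∑ i ∈ Finset.range m, f i) (∑ i ∈ Finset.range m, g i)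
    linarith
  rcases Nat.lt_or_ge (len a b n) w.length with hl | hl
  · exact bound (fun i => abs_centredOcc_le a b w _) (fun i => abs_centred_le hP c _) _ hl.le
  · -- The word fits at exactly the first `q` positions of the block.
    obtain ⟨q, hq⟩ := Nat.exists_eq_add_of_le' (by omega : w.length - 1 ≤ len a b n)
    have hmain : ∑ i ∈ Finset.range q, centredOcc a b w (offset a b n + i)
        = ∑ k ∈ Finset.range q, centred (a ^ w.length) c ((dropDigit a b)^[k] n) := by
      rw [← Finset.sum_range_reflect]
      refine Finset.sum_congr rfl fun k hk => ?_
      have hk' := Finset.mem_range.1 hk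
      have := hc n q (q - 1 - k) (by omega) (by omega)
      rw [show q - 1 - (q - 1 - k) = k by omega] at this
      simp [centredOcc, centred, this]
    rw [hq, Finset.sum_range_add, Finset.sum_range_add, hmain, add_sub_add_left_eq_sub]
    exact bound (fun i => abs_centredOcc_le a b w _) (fun i => abs_centred_le hP c _) _ (by omega)

/-! ### Normality -/

/-- Most numbers below `n` have almost as many digits as `n`. -/
theorem exists_mul_len_le {a b : ℕ} (hb : 0 < b) (hab : b < a) :
    ∃ q : ℕ, ∀ n, n * len a b n ≤ 2 * offset a b n + q * n := by
  have hθ : 1 < (a : ℝ) / b := by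
    rw [one_lt_div (by exact_mod_cast hb)]; exact_mod_cast hab
  obtain ⟨q, hq⟩ := pow_unbounded_of_one_lt 2 hθ
  refine ⟨q, fun n => ?_⟩
  -- Deleting `q` digits at least halves `n`, so every `j ≥ m` has at least `len n - q` digits.
  set m := (dropDigit a b)^[q] n with hm
  have h1 : 2 * m ≤ n := by
    have h := pow_mul_dropDigit_iterate_le hb hab q n
    have : (2 : ℝ) * m ≤ n := le_trans (by gcongr) h
    exact_mod_cast this
  have h2 : len a b n ≤ q + len a b m := len_le_add_len_iterate hab q n
  have h3 : (n - m) * len a b m ≤ offset a b n := by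
    have hs := sum_range_offset a b (fun _ => 1) n
    simp only [Finset.sum_const, Finset.card_range, smul_eq_mul, mul_one] at hs
    rw [hs, ← Finset.sum_range_add_sum_Ico _ (by omega : m ≤ n), ← Nat.card_Ico, ← smul_eq_mul]
    exact (Finset.card_nsmul_le_sum _ _ _ fun j hj =>
      len_mono hab (Finset.mem_Ico.1 hj).1).trans (Nat.le_add_left _ _)
  have h4 : n * len a b m ≤ 2 * (n - m) * len a b m := Nat.mul_le_mul_right _ (by omega)
  nlinarith

/-- The discrepancy of a word among the first `N` positions, for every cut-off `J`. The number
`blockIndex a b N` is of smaller order than `N`. -/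
theorem exists_abs_sum_centredOcc_le {a b : ℕ} [NeZero a] (hb : 0 < b) (hab : b < a)
    (hco : a.Coprime b) {w : List (Fin a)} (hw : w ≠ []) (J : ℕ) :
    ∃ K : ℝ, ∀ N : ℕ, |∑ p ∈ Finset.range N, centredOcc a b w p|
      ≤ K * blockIndex a b N + 2 * (((b : ℝ) / a) ^ J * liftError a b) * N := by
  obtain ⟨c, hc⟩ := exists_abs_sum_block_sub_le hab hco hw
  obtain ⟨K, hK⟩ := exists_abs_sum_sum_centred_le hb hab (pow_pos (NeZero.pos a) w.length)
    (hco.pow_left _) c J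
  obtain ⟨q, hq⟩ := exists_mul_len_le hb hab
  have hA : 0 ≤ ((b : ℝ) / a) ^ J * liftError a b :=
    mul_nonneg (by positivity) (liftError_nonneg hab)
  set A := ((b : ℝ) / a) ^ J * liftError a b
  refine ⟨2 * w.length + K + A * q + 1, fun N => ?_⟩
  set n := blockIndex a b N with hn
  have h1 : offset a b n ≤ N := offset_blockIndex_le a b N
  have h2 : N < offset a b (n + 1) := lt_offset_blockIndex_succ hab N
  rw [offset_succ] at h2
  have hrest : |∑ i ∈ Finset.range (N - offset a b n), centredOcc a b w (offset a b n + i)|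
      ≤ n := by
    refine (abs_sum_range_le_card (fun i => abs_centredOcc_le a b w _) _).trans ?_
    have := len_le_self hab n
    exact_mod_cast (by omega : N - offset a b n ≤ n)
  have hdiff : |∑ j ∈ Finset.range n, (∑ i ∈ Finset.range (len a b j),
      centredOcc a b w (offset a b j + i) - ∑ k ∈ Finset.range (len a b j),
        centred (a ^ w.length) c ((dropDigit a b)^[k] j))| ≤ 2 * w.length * n := by
    refine (Finset.abs_sum_le_sum_abs _ _).trans ((Finset.sum_le_card_nsmul _ _ _
      fun j _ => hc j).trans_eq ?_)
    simp; ring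
  have hqR : (n : ℝ) * len a b n ≤ 2 * N + q * n := by
    have := hq n
    exact_mod_cast (by omega : n * len a b n ≤ 2 * N + q * n)
  have hAq := mul_le_mul_of_nonneg_left hqR hA
  have hKn := hK n
  have hsum : ∑ p ∈ Finset.range N, centredOcc a b w p
      = ∑ j ∈ Finset.range n, (∑ i ∈ Finset.range (len a b j),
          centredOcc a b w (offset a b j + i) - ∑ k ∈ Finset.range (len a b j),
            centred (a ^ w.length) c ((dropDigit a b)^[k] j))
        + ∑ j ∈ Finset.range n, ∑ k ∈ Finset.range (len a b j),
            centred (a ^ w.length) c ((dropDigit a b)^[k] j)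
        + ∑ i ∈ Finset.range (N - offset a b n), centredOcc a b w (offset a b n + i) := by
    rw [Finset.sum_sub_distrib, sub_add_cancel, ← sum_range_offset, ← Finset.sum_range_add,
      Nat.add_sub_cancel' h1]
  rw [hsum]
  refine (abs_add_three _ _ _).trans ?_
  linarith

theorem tendsto_len_blockIndex {a b : ℕ} (hb : 0 < b) (hab : b < a) :
    Tendsto (fun N => len a b (blockIndex a b N)) atTop atTop := by
  rw [tendsto_atTop]
  intro l
  filter_upwards [eventually_ge_atTop (offset a b ((leastLift a b)^[l] 1))] with N hN
  have h1 : (leastLift a b)^[l] 1 ≤ blockIndex a b N := by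
    by_contra! h
    have h2 := offset_mono a b h
    have h3 := lt_offset_blockIndex_succ hab N
    simp only [Nat.succ_eq_add_one] at h2
    omega
  have h2 := (galoisConnection_iterate hb (by omega : 0 < a) l _ _).1 h1
  exact ((lt_len_iff hab _ _).2 h2).le

/-- The number of blocks is of smaller order than their total length. -/
theorem tendsto_blockIndex_div {a b : ℕ} (hb : 0 < b) (hab : b < a) :
    Tendsto (fun N => (blockIndex a b N : ℝ) / N) atTop (𝓝 0) := by
  obtain ⟨q, hq⟩ := exists_mul_len_le hb hab
  have hlim : Tendsto (fun N => 2 / (((len a b (blockIndex a b N) : ℕ) : ℝ) - q)) atTop (𝓝 0) :=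
    tendsto_const_nhds.div_atTop (tendsto_atTop_add_const_right _ (-(q : ℝ))
      (tendsto_natCast_atTop_atTop.comp (tendsto_len_blockIndex hb hab)))
  refine squeeze_zero' (Eventually.of_forall fun N => by positivity) ?_ hlim
  filter_upwards [(tendsto_len_blockIndex hb hab).eventually_gt_atTop q, eventually_gt_atTop 0]
    with N hN hN0
  have h1 : (q : ℝ) < (len a b (blockIndex a b N) : ℕ) := by exact_mod_cast hN
  have h2 : (0 : ℝ) < N := by exact_mod_cast hN0
  have h3 : ((blockIndex a b N : ℕ) : ℝ) * (len a b (blockIndex a b N) : ℕ)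
      ≤ 2 * N + q * (blockIndex a b N : ℕ) := by
    have h4 := hq (blockIndex a b N)
    have h5 := offset_blockIndex_le a b N
    exact_mod_cast (by omega : blockIndex a b N * len a b (blockIndex a b N)
      ≤ 2 * N + q * blockIndex a b N)
  rw [div_le_div_iff₀ h2 (by linarith)]
  linarith

theorem tendsto_sum_centredOcc_div {a b : ℕ} [NeZero a] (hb : 0 < b) (hab : b < a)
    (hco : a.Coprime b) {w : List (Fin a)} (hw : w ≠ []) :
    Tendsto (fun N : ℕ => (∑ p ∈ Finset.range N, centredOcc a b w p) / N) atTop (𝓝 0) := by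
  rw [Metric.tendsto_nhds]
  intro ε hε
  have hρ : (b : ℝ) / a < 1 := by
    rw [div_lt_one (by exact_mod_cast (by omega : 0 < a))]; exact_mod_cast hab
  have hJ : Tendsto (fun J : ℕ => 2 * (((b : ℝ) / a) ^ J * liftError a b)) atTop (𝓝 0) := by
    simpa using ((tendsto_pow_atTop_nhds_zero_of_lt_one (by positivity) hρ).mul_const
      (liftError a b)).const_mul 2
  obtain ⟨J, hJ⟩ := (hJ.eventually_lt_const (half_pos hε)).exists
  obtain ⟨K, hK⟩ := exists_abs_sum_centredOcc_le hb hab hco hw J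
  have hB : Tendsto (fun N => K * ((blockIndex a b N : ℝ) / N)) atTop (𝓝 0) := by
    simpa using (tendsto_blockIndex_div hb hab).const_mul K
  filter_upwards [hB.eventually_lt_const (half_pos hε), eventually_gt_atTop 0] with N hN hN0
  have h2 : (0 : ℝ) < N := by exact_mod_cast hN0
  rw [Real.dist_eq, sub_zero, abs_div, abs_of_pos h2, div_lt_iff₀ h2]
  rw [mul_div_assoc', div_lt_iff₀ h2] at hN
  nlinarith [hK N]

theorem isNormal_champernowne {a b : ℕ} [NeZero a] (hb : 0 < b) (hab : b < a)
    (hco : a.Coprime b) : IsNormal a (champernowne a b) := by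
  intro w
  have hIoo := champernowne_mem_Ioo hb hab
  rw [Int.fract_eq_self.2 ⟨hIoo.1.le, hIoo.2⟩, digits_champernowne hb hab]
  rcases eq_or_ne w [] with rfl | hw
  · refine (tendsto_congr' ?_).2 tendsto_const_nhds
    filter_upwards [eventually_gt_atTop 0] with N hN
    have : (N : ℝ) ≠ 0 := by positivity
    simp [countWord, this]
  · have h := (tendsto_sum_centredOcc_div hb hab hco hw).add_const (1 / (a : ℝ) ^ w.length)
    rw [zero_add] at h
    refine h.congr' ?_
    filter_upwards [eventually_gt_atTop 0] with N hN
    have hN' : (N : ℝ) ≠ 0 := by positivity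
    have hcount : (countWord (concat a b) w N : ℝ)
        = ∑ p ∈ Finset.range N, centredOcc a b w p + N * (1 / (a : ℝ) ^ w.length) := by
      simp only [centredOcc, Finset.sum_sub_distrib, Finset.sum_const, Finset.card_range,
        nsmul_eq_mul, sub_add_cancel, countWord, Finset.card_filter, Nat.cast_sum, Nat.cast_ite,
        Nat.cast_one, Nat.cast_zero, OccursAt]
      exact Finset.sum_congr rfl fun p _ => by congr
    rw [hcount]
    field_simp

end RationalBase

theorem corollaryc2 (a b : ℕ) [NeZero a] (hb : 1 ≤ b) (hab : b < a) (hco : Nat.Coprime a b) :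
    RationalBase.champernowne a b ∈ Set.Ioo (0 : ℝ) 1 ∧
    (∀ n : ℕ, 1 ≤ n → ∀ k : ℕ, k < RationalBase.len a b n →
      (Real.digits (RationalBase.champernowne a b) a (RationalBase.offset a b n + k) : ℕ) =
        RationalBase.digit a b (RationalBase.len a b n - 1 - k) n) ∧
    RationalBase.IsNormal a (RationalBase.champernowne a b) := by
  refine ⟨RationalBase.champernowne_mem_Ioo hb hab, fun n _ k hk => ?_,
    RationalBase.isNormal_champernowne hb hab hco⟩
  rw [RationalBase.digits_champernowne hb hab]
  exact RationalBase.concat_offset_add hab hk
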